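/- Let $(M,\omega)$ be a symplectic manifold of dimension $2n$, that is, a smooth manifold (Hausdorff, second countable, without boundary) with a closed, nondegenerate smooth $2$-form $\omega$, oriented by $\omega^n$. Let $\mathfrak X^{c}_{ex}(M,\omega)$ be the set of all smooth vector fields $X$ on $M$ with compact support for which $i_X\omega = dh$ for some smooth function $h\colon M\to\mathbb R$ (the compactly supported Hamiltonian vector fields). Then $\mathfrak X^{c}_{ex}(M,\omega)$ is big enough to detect the vanishing of a symmetric $2$-tensor field: if $T\in\Gamma(S^2T^*M)$ is a smooth symmetric $2$-tensor field such that $$\int_M T(X,Y)\,\omega^n = 0 \quad\text{for all } X,Y\in\mathfrak X^{c}_{ex}(M,\omega),$$ then $T=0$. -/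

import Mathlib

/-!
Evaluating `Ωⁿ` on a symplectic basis shows that it vanishes nowhere, so `|Ωⁿ|` has a positive
continuous density in every chart: a nonnegative continuous function with compact support that is
positive somewhere has positive integral.

Write `X_h` for the Hamiltonian field of `h`. The fields of `a cos φ` and `a sin φ`, with `a` of
compact support, are `X_a` and `a X_φ` rotated by the angle `φ` at each point. The cross terms
therefore cancel in
`T(X_{a cos φ}, X_{a cos φ}) + T(X_{a sin φ}, X_{a sin φ}) = T(X_a, X_a) + a² T(X_φ, X_φ)`,
and the hypothesis gives `∫ a² T(X_φ, X_φ) Ωⁿ = 0` for all bump functions `a`, hence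
`T(X_φ, X_φ) = 0`. Every tangent vector is a value of some `X_φ`, so the quadratic form of `T`
vanishes, and `T` vanishes by polarization.
-/

open scoped Manifold ContDiff
open MeasureTheory

noncomputable section

/-- A smooth differential `k`-form on a manifold `M` without boundary modelled on `E`: an
alternating `k`-linear form on each tangent space, whose pullback by the inverse of each chart is
a smooth function on the target of the chart. -/
structure DiffForm (E : Type*) [NormedAddCommGroup E] [NormedSpace ℝ E] (M : Type*)
    [TopologicalSpace M] [ChartedSpace E M] (k : ℕ) where
  /-- the value at a point -/
  val : ∀ x : M, TangentSpace 𝓘(ℝ, E) x [⋀^Fin k]→L[ℝ] ℝ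
  smooth : ∀ φ ∈ atlas E M, ContDiffOn ℝ ∞
    (fun y : E => ((val (φ.symm y)).compContinuousLinearMap
      (mfderiv 𝓘(ℝ, E) 𝓘(ℝ, E) φ.symm y) : E [⋀^Fin k]→L[ℝ] ℝ)) φ.target

namespace DiffForm

variable {E : Type*} [NormedAddCommGroup E] [NormedSpace ℝ E] {M : Type*}
  [TopologicalSpace M] [ChartedSpace E M] {k : ℕ}

/-- The coordinate representation `(φ⁻¹)^* α` of a form `α` in the chart `φ`. -/
def inChart (α : DiffForm E M k) (φ : OpenPartialHomeomorph M E) (y : E) :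
    E [⋀^Fin k]→L[ℝ] ℝ :=
  (α.val (φ.symm y)).compContinuousLinearMap (mfderiv 𝓘(ℝ, E) 𝓘(ℝ, E) φ.symm y)

/-- `dα = 0`: in every chart the exterior derivative of the coordinate representation vanishes. -/
def Closed (α : DiffForm E M k) : Prop :=
  ∀ φ ∈ atlas E M, ∀ y ∈ φ.target, extDeriv (α.inChart φ) y = 0

/-- A symplectic form: a closed 2-form that is nondegenerate on every tangent space. -/
def IsSymplectic (Ω : DiffForm E M 2) : Prop :=
  Ω.Closed ∧
    ∀ (x : M) (v : TangentSpace 𝓘(ℝ, E) x), (∀ w, Ω.val x ![v, w] = 0) → v = 0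

end DiffForm

/-- The value `(α ∧ ⋯ ∧ α) (v₁, …, v₂ₙ)` of the `n`-th exterior power of an alternating 2-form:
`2⁻ⁿ ∑_σ sign σ ∏ᵢ α (v_{σ(2i-1)}, v_{σ(2i)})`, the sum being over all permutations. -/
def wedgePow {V : Type*} [AddCommGroup V] [Module ℝ V] [TopologicalSpace V]
    (α : V [⋀^Fin 2]→L[ℝ] ℝ) (n : ℕ) (v : Fin (2 * n) → V) : ℝ :=
  (2 ^ n)⁻¹ * ∑ σ : Equiv.Perm (Fin (2 * n)), ((Equiv.Perm.sign σ : ℤ) : ℝ) *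
    ∏ i : Fin n, α ![v (σ ⟨2 * i, by omega⟩), v (σ ⟨2 * i + 1, by omega⟩)]

section

variable (n : ℕ) (M : Type*) [TopologicalSpace M]
  [ChartedSpace (EuclideanSpace ℝ (Fin (2 * n))) M]
  [IsManifold 𝓘(ℝ, EuclideanSpace ℝ (Fin (2 * n))) ∞ M]

/-- The smooth vector fields on `M`. -/
abbrev SmoothVectorField :=
  Cₛ^∞⟮𝓘(ℝ, EuclideanSpace ℝ (Fin (2 * n))); EuclideanSpace ℝ (Fin (2 * n)),
    fun x : M => TangentSpace 𝓘(ℝ, EuclideanSpace ℝ (Fin (2 * n))) x⟯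

/-- The smooth tensor fields of type `(0, 2)` on `M`: smooth families of bilinear forms on the
tangent spaces. -/
abbrev SmoothTwoTensor :=
  Cₛ^∞⟮𝓘(ℝ, EuclideanSpace ℝ (Fin (2 * n)));
    EuclideanSpace ℝ (Fin (2 * n)) →L[ℝ] EuclideanSpace ℝ (Fin (2 * n)) →L[ℝ] ℝ,
    fun x : M => TangentSpace 𝓘(ℝ, EuclideanSpace ℝ (Fin (2 * n))) x →L[ℝ]
      TangentSpace 𝓘(ℝ, EuclideanSpace ℝ (Fin (2 * n))) x →L[ℝ] ℝ⟯

/-- A smooth partition of unity `(ρ_p)_{p ∈ M}` subordinate to the cover of `M` by the domains of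
the charts `chartAt _ p`. -/
def chartPartition [T2Space M] [SigmaCompactSpace M] :
    SmoothPartitionOfUnity M 𝓘(ℝ, EuclideanSpace ℝ (Fin (2 * n))) M :=
  Classical.choose (SmoothPartitionOfUnity.exists_isSubordinate_chartAt_source
    𝓘(ℝ, EuclideanSpace ℝ (Fin (2 * n))) M)

end

section

variable {n : ℕ} {M : Type*} [TopologicalSpace M]
  [ChartedSpace (EuclideanSpace ℝ (Fin (2 * n))) M]
  [IsManifold 𝓘(ℝ, EuclideanSpace ℝ (Fin (2 * n))) ∞ M]

/-- The integral `∫_M f Ωⁿ`, for `f` continuous with compact support: the sum over the partition of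
unity of the integrals of `ρ_p f Ωⁿ`, computed in the chart at `p`. The manifold carries the
orientation given by `Ωⁿ`, so that in a chart, whether it preserves the orientation or not, the
integral of `g Ωⁿ` is the Lebesgue integral of `g |Ωⁿ(∂₁, …, ∂₂ₙ)|`. -/
def symplecticIntegral [T2Space M] [SigmaCompactSpace M]
    (Ω : DiffForm (EuclideanSpace ℝ (Fin (2 * n))) M 2) (f : M → ℝ) : ℝ :=
  ∑ᶠ p : M, ∫ y in (chartAt (EuclideanSpace ℝ (Fin (2 * n))) p).target,
    chartPartition n M p ((chartAt (EuclideanSpace ℝ (Fin (2 * n))) p).symm y) *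
      f ((chartAt (EuclideanSpace ℝ (Fin (2 * n))) p).symm y) *
      |wedgePow (Ω.inChart (chartAt (EuclideanSpace ℝ (Fin (2 * n))) p) y) n
        (fun j => EuclideanSpace.single j (1 : ℝ))|

/-- The compactly supported Hamiltonian vector fields of `(M, Ω)`: the smooth vector fields `X` with
compact support such that `Ω(X, ·) = dh` for some smooth function `h` on `M`. -/
def compactHamiltonianFields (Ω : DiffForm (EuclideanSpace ℝ (Fin (2 * n))) M 2) :
    Set (SmoothVectorField n M) :=
  {X | IsCompact (closure {x : M | X x ≠ 0}) ∧
    ∃ h : M → ℝ, ContMDiff 𝓘(ℝ, EuclideanSpace ℝ (Fin (2 * n))) 𝓘(ℝ, ℝ) ∞ h ∧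
      ∀ (x : M) (v : TangentSpace 𝓘(ℝ, EuclideanSpace ℝ (Fin (2 * n))) x),
        Ω.val x ![X x, v] = mfderiv 𝓘(ℝ, EuclideanSpace ℝ (Fin (2 * n))) 𝓘(ℝ, ℝ) h x v}

/-- A set `𝔤` of (compactly supported) vector fields is big enough to detect the vanishing of a
symmetric 2-tensor field: a smooth symmetric 2-tensor field `T` with `∫_M T(X, Y) Ωⁿ = 0` for all
`X, Y ∈ 𝔤` is zero. -/
def DetectsSymmetricTensors [T2Space M] [SigmaCompactSpace M]
    (Ω : DiffForm (EuclideanSpace ℝ (Fin (2 * n))) M 2) (𝔤 : Set (SmoothVectorField n M)) : Prop :=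
  ∀ T : SmoothTwoTensor n M, (∀ (x : M) (v w), T x v w = T x w v) →
    (∀ X ∈ 𝔤, ∀ Y ∈ 𝔤, symplecticIntegral Ω (fun x => T x (X x) (Y x)) = 0) →
    ∀ (x : M) (v w), T x v w = 0

end

end

open Module (finrank)

noncomputable section

section Symplectic

variable {K V : Type*} [Field K] [AddCommGroup V] [Module K V] {B : LinearMap.BilinForm K V}

/-- A family of hyperbolic pairs `b (i, 0), b (i, 1)` of a bilinear form `B`, pairwise orthogonal
for distinct `i`. When `B` is alternating and the family spans, this is a symplectic basis. -/
structure IsSymplecticFamily {ι : Type*} (B : LinearMap.BilinForm K V) (b : ι × Fin 2 → V) :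
    Prop where
  apply_pair (i : ι) : B (b (i, 0)) (b (i, 1)) = 1
  apply_of_ne {p q : ι × Fin 2} (hpq : p.1 ≠ q.1) : B (b p) (b q) = 0

theorem exists_apply_eq_one [Nontrivial V] (hB : B.Nondegenerate) : ∃ u w, B u w = 1 := by
  obtain ⟨u, w, huw⟩ : ∃ u w, B u w ≠ 0 := by
    by_contra! h
    exact hB.1.ne_zero (LinearMap.ext₂ h)
  exact ⟨u, (B u w)⁻¹ • w, by simp [huw]⟩

theorem coeff_eq_zero_of_apply_eq_zero (hB : B.IsAlt) {u w : V} (huw : B u w = 1) {s t : K}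
    (hu : B u (s • u + t • w) = 0) (hw : B w (s • u + t • w) = 0) : s = 0 ∧ t = 0 := by
  have hwu : B w u = -1 := by rw [← huw, hB.neg_eq]
  exact ⟨by simpa [hB.self_eq_zero, hwu] using hw, by simpa [hB.self_eq_zero, huw] using hu⟩

theorem disjoint_span_pair_orthogonal (hB : B.IsAlt) {u w : V} (huw : B u w = 1) :
    Disjoint (Submodule.span K {u, w}) (B.orthogonal (Submodule.span K {u, w})) := by
  rw [Submodule.disjoint_def]
  intro x hx hx'
  obtain ⟨s, t, rfl⟩ := Submodule.mem_span_pair.1 hx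
  obtain ⟨rfl, rfl⟩ := coeff_eq_zero_of_apply_eq_zero hB huw
    (hx' u (Submodule.mem_span_of_mem (by simp))) (hx' w (Submodule.mem_span_of_mem (by simp)))
  simp

theorem finrank_span_pair_of_apply_eq_one (hB : B.IsAlt) {u w : V} (huw : B u w = 1) :
    finrank K (Submodule.span K {u, w}) = 2 := by
  have hli : LinearIndependent K ![u, w] := LinearIndependent.pair_iff.2 fun s t hst =>
    coeff_eq_zero_of_apply_eq_zero hB huw (by rw [hst, map_zero]) (by rw [hst, map_zero])
  rw [← Matrix.range_cons_cons_empty u w ![], finrank_span_eq_card hli, Fintype.card_fin]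

theorem IsSymplecticFamily.cons {n : ℕ} {b : Fin n × Fin 2 → V} (hb : IsSymplecticFamily B b)
    (hB : B.IsAlt) {u w : V} (huw : B u w = 1) (hu : ∀ p, B u (b p) = 0)
    (hw : ∀ p, B w (b p) = 0) :
    IsSymplecticFamily B
      (Function.uncurry (Fin.cons ![u, w] (Function.curry b) : Fin (n + 1) → Fin 2 → V)) where
  apply_pair := Fin.cases huw hb.apply_pair
  apply_of_ne {p q} hpq := by
    have hpair (a : Fin 2) (r : Fin n × Fin 2) : B (![u, w] a) (b r) = 0 := by
      fin_cases a
      exacts [hu r, hw r]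
    obtain ⟨i, a⟩ := p
    obtain ⟨j, c⟩ := q
    cases i using Fin.cases <;> cases j using Fin.cases
    · exact absurd rfl hpq
    · exact hpair a _
    · exact hB.isRefl _ _ (hpair c _)
    · exact hb.apply_of_ne fun h => hpq (congrArg Fin.succ h)

theorem exists_isSymplecticFamily {n : ℕ} {V : Type*} [AddCommGroup V] [Module K V]
    {B : LinearMap.BilinForm K V} (hB : B.IsAlt) (hnd : B.Nondegenerate)
    (hV : finrank K V = 2 * n) : ∃ b : Fin n × Fin 2 → V, IsSymplecticFamily B b := by
  induction n generalizing V with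
  | zero => exact ⟨fun p => p.1.elim0, fun i => i.elim0, fun {p} => p.1.elim0⟩
  | succ n ih =>
    have : FiniteDimensional K V := .of_finrank_pos (by lia)
    have : Nontrivial V := Module.nontrivial_of_finrank_pos (R := K) (by lia)
    obtain ⟨u, w, huw⟩ := exists_apply_eq_one hnd
    set W := Submodule.span K {u, w}
    have hdisj : Disjoint W (B.orthogonal W) := disjoint_span_pair_orthogonal hB huw
    have hdim : finrank K (B.orthogonal W) = 2 * n := by
      rw [LinearMap.BilinForm.finrank_orthogonal hnd, hV, finrank_span_pair_of_apply_eq_one hB huw]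
      lia
    have hnd' : (B.restrict (B.orthogonal W)).Nondegenerate := by
      refine B.nondegenerate_restrict_of_disjoint_orthogonal hB.isRefl ?_
      rw [LinearMap.BilinForm.orthogonal_orthogonal hnd hB.isRefl]
      exact hdisj.symm
    obtain ⟨b, hb⟩ := ih (B := B.restrict (B.orthogonal W)) (fun x => hB x) hnd' hdim
    have hb' : IsSymplecticFamily B (fun p => (b p : V)) := ⟨hb.apply_pair, hb.apply_of_ne⟩
    exact ⟨_, hb'.cons hB huw (fun p => (b p).2 u (Submodule.mem_span_of_mem (by simp)))
      (fun p => (b p).2 w (Submodule.mem_span_of_mem (by simp)))⟩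

end Symplectic

theorem exists_eq_prodCongr_of_fst_eq {ι κ : Type*} [Finite ι] [Finite κ] [Nonempty κ]
    {σ : Equiv.Perm (ι × κ)} (hσ : ∀ i a c, (σ (i, a)).1 = (σ (i, c)).1) :
    ∃ (τ : Equiv.Perm ι) (ε : ι → Equiv.Perm κ),
      σ = (Equiv.prodCongrLeft fun _ => τ) * Equiv.prodCongrRight ε := by
  let a₀ : κ := Classical.arbitrary κ
  have hτ : Function.Bijective fun i => (σ (i, a₀)).1 := by
    refine Finite.surjective_iff_bijective.1 fun j => ?_
    obtain ⟨⟨i, a⟩, hi⟩ := σ.surjective (j, a₀)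
    exact ⟨i, by rw [hσ i a₀ a, hi]⟩
  have hε (i : ι) : Function.Bijective fun a => (σ (i, a)).2 :=
    Finite.injective_iff_bijective.1 fun a c hac =>
      congrArg Prod.snd (σ.injective (Prod.ext (hσ i a c) hac))
  exact ⟨.ofBijective _ hτ, fun i => .ofBijective _ (hε i),
    Equiv.ext fun p => Prod.ext (hσ p.1 p.2 a₀) rfl⟩

theorem sign_prodCongrLeft_const_mul_prodCongrRight {ι κ : Type*} [Fintype ι] [DecidableEq ι]
    [Fintype κ] [DecidableEq κ] (τ : Equiv.Perm ι) (ε : ι → Equiv.Perm κ) :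
    Equiv.Perm.sign ((Equiv.prodCongrLeft fun _ => τ) * Equiv.prodCongrRight ε) =
      Equiv.Perm.sign τ ^ Fintype.card κ * ∏ i, Equiv.Perm.sign (ε i) := by
  rw [Equiv.Perm.sign_mul, Equiv.Perm.sign_prodCongrLeft, Equiv.Perm.sign_prodCongrRight,
    Finset.prod_const, Finset.card_univ]

section

variable {K V ι : Type*} [Field K] [AddCommGroup V] [Module K V] {B : LinearMap.BilinForm K V}
  {b : ι × Fin 2 → V}

theorem IsSymplecticFamily.apply_perm (hb : IsSymplecticFamily B b) (hB : B.IsAlt) (i : ι)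
    (ε : Equiv.Perm (Fin 2)) :
    B (b (i, ε 0)) (b (i, ε 1)) = ((Equiv.Perm.sign ε : ℤ) : K) := by
  obtain rfl | rfl : ε = 1 ∨ ε = Equiv.swap 0 1 := by
    revert ε
    decide
  · simpa using hb.apply_pair i
  · rw [Equiv.swap_apply_left, Equiv.swap_apply_right, ← hB.neg_eq, hb.apply_pair,
      Equiv.Perm.sign_swap (by decide)]
    simp

/-- If `σ` permutes the pairs, its sign is the product of its signs inside the pairs, and so is the
product of the values of `B`. -/
theorem IsSymplecticFamily.sign_mul_prod [Fintype ι] [DecidableEq ι]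
    (hb : IsSymplecticFamily B b) (hB : B.IsAlt) (σ : Equiv.Perm (ι × Fin 2)) :
    ((Equiv.Perm.sign σ : ℤ) : K) * ∏ i, B (b (σ (i, 0))) (b (σ (i, 1))) =
      if ∀ i, (σ (i, 0)).1 = (σ (i, 1)).1 then 1 else 0 := by
  split_ifs with hσ
  · obtain ⟨τ, ε, rfl⟩ : ∃ (τ : Equiv.Perm ι) (ε : ι → Equiv.Perm (Fin 2)),
        σ = (Equiv.prodCongrLeft fun _ => τ) * Equiv.prodCongrRight ε :=
      exists_eq_prodCongr_of_fst_eq fun i => by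
        simpa [Fin.forall_fin_two] using ⟨hσ i, (hσ i).symm⟩
    have hsign : Equiv.Perm.sign ((Equiv.prodCongrLeft fun _ => τ) * Equiv.prodCongrRight ε) =
        ∏ i, Equiv.Perm.sign (ε i) := by
      rw [sign_prodCongrLeft_const_mul_prodCongrRight, Fintype.card_fin, Int.units_sq, one_mul]
    have hpair (i : ι) : B (b (τ i, ε i 0)) (b (τ i, ε i 1)) = ((Equiv.Perm.sign (ε i) : ℤ) : K) :=
      hb.apply_perm hB (τ i) (ε i)
    rw [hsign]
    simp only [Equiv.Perm.mul_apply, Equiv.prodCongrRight_apply, Equiv.prodCongrLeft_apply, hpair]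
    rw [← Int.cast_prod, ← Units.coe_prod, ← Int.cast_mul, ← Units.val_mul, Int.units_mul_self,
      Units.val_one, Int.cast_one]
  · push Not at hσ
    obtain ⟨i, hi⟩ := hσ
    rw [Finset.prod_eq_zero (Finset.mem_univ i) (hb.apply_of_ne hi), mul_zero]

theorem IsSymplecticFamily.sum_sign_mul_prod_ne_zero [CharZero K] [Fintype ι] [DecidableEq ι]
    (hb : IsSymplecticFamily B b) (hB : B.IsAlt) :
    ∑ σ : Equiv.Perm (ι × Fin 2),
      ((Equiv.Perm.sign σ : ℤ) : K) * ∏ i, B (b (σ (i, 0))) (b (σ (i, 1))) ≠ 0 := by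
  simp only [hb.sign_mul_prod hB, Finset.sum_boole]
  exact Nat.cast_ne_zero.2 (Finset.card_ne_zero_of_mem (a := 1) (by simp))

end

/-- The bilinear form `(v, w) ↦ α (v, w)` underlying an alternating form of degree two. -/
def bilinOfAlternating {R V : Type*} [CommRing R] [AddCommGroup V] [Module R V]
    (α : V [⋀^Fin 2]→ₗ[R] R) : LinearMap.BilinForm R V :=
  LinearMap.mk₂ R (fun v w => α ![v, w]) (fun v v' w => α.map_vecCons_add ![w] v v')
    (fun c v w => α.map_vecCons_smul ![w] c v)
    (fun v w w' => (α.curryLeft v).map_vecCons_add ![] w w')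
    (fun c v w => (α.curryLeft v).map_vecCons_smul ![] c w)

theorem isAlt_bilinOfAlternating {R V : Type*} [CommRing R] [AddCommGroup V] [Module R V]
    (α : V [⋀^Fin 2]→ₗ[R] R) : (bilinOfAlternating α).IsAlt := fun v =>
  α.map_eq_zero_of_eq ![v, v] (i := 0) (j := 1) rfl (by decide)

theorem nondegenerate_bilinOfAlternating_iff {R V : Type*} [CommRing R] [AddCommGroup V]
    [Module R V] {α : V [⋀^Fin 2]→ₗ[R] R} :
    (bilinOfAlternating α).Nondegenerate ↔ ∀ v, (∀ w, α ![v, w] = 0) → v = 0 :=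
  (isAlt_bilinOfAlternating α).isRefl.nondegenerate_iff_separatingLeft

section

variable {V : Type*} [AddCommGroup V] [Module ℝ V] [TopologicalSpace V]

/-- The pairing `(i, a) ↦ 2 i + a` of the indices of `wedgePow`. -/
def finPairEquiv (n : ℕ) : Fin n × Fin 2 ≃ Fin (2 * n) :=
  finProdFinEquiv.trans (finCongr (Nat.mul_comm n 2))

theorem finPairEquiv_zero {n : ℕ} (i : Fin n) :
    finPairEquiv n (i, 0) = ⟨2 * i, by lia⟩ := by
  ext; simp [finPairEquiv]

theorem finPairEquiv_one {n : ℕ} (i : Fin n) :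
    finPairEquiv n (i, 1) = ⟨2 * i + 1, by lia⟩ := by
  ext; simp [finPairEquiv, Nat.add_comm]

/-- The multilinear form `v ↦ ∏ᵢ α (v₂ᵢ, v₂ᵢ₊₁)`, whose alternatization is `2ⁿ αⁿ`. -/
def pairProduct (α : V [⋀^Fin 2]→L[ℝ] ℝ) (n : ℕ) :
    MultilinearMap ℝ (fun _ : Fin (2 * n) => V) ℝ :=
  MultilinearMap.domDomCongr ((Equiv.sigmaEquivProd (Fin n) (Fin 2)).trans (finPairEquiv n))
    ((MultilinearMap.mkPiAlgebra ℝ (Fin n) ℝ).compMultilinearMap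
      (fun _ : Fin n => α.toMultilinearMap))

theorem pairProduct_apply (α : V [⋀^Fin 2]→L[ℝ] ℝ) (n : ℕ) (v : Fin (2 * n) → V) :
    pairProduct α n v =
      ∏ i : Fin n, α ![v (finPairEquiv n (i, 0)), v (finPairEquiv n (i, 1))] := by
  simp only [pairProduct, MultilinearMap.domDomCongr_apply,
    MultilinearMap.compMultilinearMap_apply, MultilinearMap.mkPiAlgebra_apply]
  refine Finset.prod_congr rfl fun i _ => congrArg (α : (Fin 2 → V) → ℝ) ?_
  ext a
  fin_cases a <;> rfl

theorem alternatization_pairProduct_apply (α : V [⋀^Fin 2]→L[ℝ] ℝ) (n : ℕ)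
    (v : Fin (2 * n) → V) :
    MultilinearMap.alternatization (pairProduct α n) v = 2 ^ n * wedgePow α n v := by
  rw [wedgePow, mul_inv_cancel_left₀ (by positivity), MultilinearMap.alternatization_apply]
  refine Finset.sum_congr rfl fun σ _ => ?_
  simp only [MultilinearMap.domDomCongr_apply, pairProduct_apply, finPairEquiv_zero,
    finPairEquiv_one, Units.smul_def, zsmul_eq_mul]

theorem two_pow_mul_wedgePow_comp_symm (α : V [⋀^Fin 2]→L[ℝ] ℝ) (n : ℕ)
    (b : Fin n × Fin 2 → V) :
    2 ^ n * wedgePow α n (b ∘ (finPairEquiv n).symm) =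
      ∑ σ : Equiv.Perm (Fin n × Fin 2),
        ((Equiv.Perm.sign σ : ℤ) : ℝ) * ∏ i, α ![b (σ (i, 0)), b (σ (i, 1))] := by
  rw [wedgePow, mul_inv_cancel_left₀ (by positivity), ← (finPairEquiv n).permCongr.sum_comp]
  simp [← finPairEquiv_zero, ← finPairEquiv_one, Equiv.permCongr_apply]

theorem wedgePow_basis_ne_zero {n : ℕ} {α : V [⋀^Fin 2]→L[ℝ] ℝ}
    (hα : ∀ v, (∀ w, α ![v, w] = 0) → v = 0) (e : Module.Basis (Fin (2 * n)) ℝ V) :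
    wedgePow α n e ≠ 0 := by
  have halt := isAlt_bilinOfAlternating α.toAlternatingMap
  obtain ⟨b, hb⟩ := exists_isSymplecticFamily (n := n) halt
    (nondegenerate_bilinOfAlternating_iff.2 hα) (by simp [Module.finrank_eq_card_basis e])
  have hsum : 2 ^ n * wedgePow α n (b ∘ (finPairEquiv n).symm) ≠ 0 := by
    rw [two_pow_mul_wedgePow_comp_symm]
    exact hb.sum_sign_mul_prod_ne_zero halt
  have htop : MultilinearMap.alternatization (pairProduct α n) e ≠ 0 := by
    rw [AlternatingMap.map_basis_ne_zero_iff]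
    intro h
    rw [← alternatization_pairProduct_apply, h] at hsum
    exact hsum rfl
  rw [alternatization_pairProduct_apply] at htop
  exact right_ne_zero_of_mul htop

end

theorem contDiffOn_of_clm_apply_eq {𝕜 W V F : Type*} [NontriviallyNormedField 𝕜]
    [NormedAddCommGroup W] [NormedSpace 𝕜 W] [NormedAddCommGroup V] [NormedSpace 𝕜 V]
    [CompleteSpace V] [NormedAddCommGroup F] [NormedSpace 𝕜 F] {k : ℕ∞ω} {s : Set W}
    {A : W → V →L[𝕜] F} {Y : W → V} {β : W → F} (hA : ContDiffOn 𝕜 k A s)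
    (hβ : ContDiffOn 𝕜 k β s) (hinv : ∀ y ∈ s, (A y).IsInvertible)
    (hY : ∀ y ∈ s, A y (Y y) = β y) : ContDiffOn 𝕜 k Y s := by
  have hsol : ContDiffOn 𝕜 k (fun y => (A y).inverse (β y)) s := fun y hy =>
    ((hinv y hy).contDiffAt_map_inverse.comp_contDiffWithinAt y (hA y hy)).clm_apply (hβ y hy)
  exact hsol.congr fun y hy => by rw [← hY y hy, (hinv y hy).inverse_apply_self]

section

variable {V W : Type*} [NormedAddCommGroup V] [NormedSpace ℝ V] [FiniteDimensional ℝ V]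
  [NormedAddCommGroup W] [NormedSpace ℝ W]

theorem isInvertible_toContinuousBilinearMap {B : LinearMap.BilinForm ℝ V} (hB : B.Nondegenerate) :
    (LinearMap.toContinuousBilinearMap B).IsInvertible :=
  ⟨((B.toDual hB).trans LinearMap.toContinuousLinearMap).toContinuousLinearEquiv, rfl⟩

theorem contDiffOn_of_alternating_apply_eq {k : ℕ∞ω} {s : Set W} {α : W → V [⋀^Fin 2]→L[ℝ] ℝ}
    {Y : W → V} {β : W → V →L[ℝ] ℝ} (hα : ContDiffOn ℝ k α s) (hβ : ContDiffOn ℝ k β s)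
    (hnd : ∀ y ∈ s, ∀ v, (∀ w, α y ![v, w] = 0) → v = 0)
    (hY : ∀ y ∈ s, ∀ w, α y ![Y y, w] = β y w) : ContDiffOn ℝ k Y s := by
  have : CompleteSpace V := FiniteDimensional.complete ℝ V
  let A (y : W) : V →L[ℝ] V →L[ℝ] ℝ :=
    LinearMap.toContinuousBilinearMap (bilinOfAlternating (α y).toAlternatingMap)
  have hA : ContDiffOn ℝ k A s := contDiffOn_clm_apply.2 fun v => contDiffOn_clm_apply.2 fun w =>
    (ContinuousAlternatingMap.apply ℝ V ℝ ![v, w]).contDiff.comp_contDiffOn hα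
  exact contDiffOn_of_clm_apply_eq hA hβ
    (fun y hy => isInvertible_toContinuousBilinearMap
      (nondegenerate_bilinOfAlternating_iff.2 (hnd y hy)))
    fun y hy => ContinuousLinearMap.ext (hY y hy)

end

section

variable {𝕜 E M : Type*} [NontriviallyNormedField 𝕜] [NormedAddCommGroup E] [NormedSpace 𝕜 E]
  [TopologicalSpace M] [ChartedSpace E M]

theorem mfderiv_symm_mfderiv [IsManifold 𝓘(𝕜, E) 1 M] {φ : OpenPartialHomeomorph M E}
    (hφ : φ ∈ atlas E M) {y : E} (hy : y ∈ φ.target) (v : TangentSpace 𝓘(𝕜, E) (φ.symm y)) :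
    mfderiv% φ.symm y (mfderiv% φ (φ.symm y) v) = v := by
  have h := DFunLike.congr_fun
    ((mdifferentiable_of_mem_atlas hφ).symm_comp_deriv (φ.map_target hy)) v
  rw [φ.right_inv hy] at h
  exact h

theorem contMDiff_vectorField_of_chartAt [IsManifold 𝓘(𝕜, E) ∞ M]
    {X : ∀ x : M, TangentSpace 𝓘(𝕜, E) x}
    (hX : ∀ p : M, ContDiffOn 𝕜 ∞
      (fun y => (mfderiv% (chartAt E p) ((chartAt E p).symm y) (X ((chartAt E p).symm y)) : E))
      (chartAt E p).target) : CMDiff ∞ (T% X) := by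
  intro p
  rw [Bundle.contMDiffAt_section]
  set φ := chartAt E p
  have hp : p ∈ φ.source := mem_chart_source E p
  have hφX := (((hX p).contDiffAt (φ.open_target.mem_nhds (φ.map_source hp))).contMDiffAt.comp p
    ((contMDiffOn_chart (x := p)).contMDiffAt (φ.open_source.mem_nhds hp)))
  refine hφX.congr_of_eventuallyEq ?_
  filter_upwards [φ.open_source.mem_nhds hp] with x hx
  have hderiv := DFunLike.congr_fun
    (TangentBundle.continuousLinearMapAt_trivializationAt (I := 𝓘(𝕜, E)) hx) (X x)
  have hfiber := (trivializationAt E (TangentSpace 𝓘(𝕜, E)) p).linearMapAt_apply (R := 𝕜) (X x)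
  exact ((hfiber.trans (if_pos hx)).symm.trans hderiv).trans
    (congrArg (fun z => (mfderiv% φ z (X z) : E)) (φ.left_inv hx).symm)

end

namespace DiffForm

variable {E : Type*} [NormedAddCommGroup E] [NormedSpace ℝ E] {M : Type*} [TopologicalSpace M]
  [ChartedSpace E M] {Ω : DiffForm E M 2}

/-- Nondegeneracy of a 2-form on every tangent space; the form need not be closed. -/
def Nondegenerate (Ω : DiffForm E M 2) : Prop :=
  ∀ (x : M) (v : TangentSpace 𝓘(ℝ, E) x), (∀ w, Ω.val x ![v, w] = 0) → v = 0

theorem inChart_apply (Ω : DiffForm E M 2) (φ : OpenPartialHomeomorph M E) (y v w : E) :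
    Ω.inChart φ y ![v, w] =
      Ω.val (φ.symm y) ![mfderiv% φ.symm y v, mfderiv% φ.symm y w] :=
  congrArg (Ω.val (φ.symm y)) (by ext a; fin_cases a <;> rfl)

theorem inChart_mfderiv_apply [IsManifold 𝓘(ℝ, E) 1 M] (Ω : DiffForm E M 2)
    {φ : OpenPartialHomeomorph M E} (hφ : φ ∈ atlas E M) {y : E} (hy : y ∈ φ.target)
    (v : TangentSpace 𝓘(ℝ, E) (φ.symm y)) (w : E) :
    Ω.inChart φ y ![mfderiv% φ (φ.symm y) v, w] = Ω.val (φ.symm y) ![v, mfderiv% φ.symm y w] :=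
  (Ω.inChart_apply φ y _ w).trans
    (congrArg (fun u => Ω.val (φ.symm y) ![u, mfderiv% φ.symm y w]) (mfderiv_symm_mfderiv hφ hy v))

theorem Nondegenerate.inChart [IsManifold 𝓘(ℝ, E) 1 M] (hΩ : Ω.Nondegenerate)
    {φ : OpenPartialHomeomorph M E} (hφ : φ ∈ atlas E M) {y : E} (hy : y ∈ φ.target) (v : E)
    (hv : ∀ w, Ω.inChart φ y ![v, w] = 0) : v = 0 := by
  have hzero : mfderiv% φ.symm y v = 0 := hΩ _ _ fun w => by
    have hw := (Ω.inChart_apply φ y v _).symm.trans (hv (mfderiv% φ (φ.symm y) w))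
    exact (congrArg (fun u => Ω.val (φ.symm y) ![mfderiv% φ.symm y v, u])
      (mfderiv_symm_mfderiv hφ hy w)).symm.trans hw
  have hleft : mfderiv% φ (φ.symm y) (mfderiv% φ.symm y v) = v :=
    DFunLike.congr_fun ((mdifferentiable_of_mem_atlas hφ).comp_symm_deriv hy) v
  exact hleft.symm.trans ((congrArg (mfderiv% φ (φ.symm y)) hzero).trans (map_zero _))

variable [FiniteDimensional ℝ E]

/-- The Hamiltonian vector field `X_h` of a function `h`, defined by `Ω(X_h, ·) = dh`. -/
def hamiltonianField (hΩ : Ω.Nondegenerate) (h : M → ℝ) (x : M) : TangentSpace 𝓘(ℝ, E) x :=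
  haveI : FiniteDimensional ℝ (TangentSpace 𝓘(ℝ, E) x) := inferInstanceAs (FiniteDimensional ℝ E)
  ((bilinOfAlternating (Ω.val x).toAlternatingMap).toDual
    (nondegenerate_bilinOfAlternating_iff.2 (hΩ x))).symm (d% h x)

theorem apply_hamiltonianField (hΩ : Ω.Nondegenerate) (h : M → ℝ) (x : M)
    (v : TangentSpace 𝓘(ℝ, E) x) : Ω.val x ![hamiltonianField hΩ h x, v] = d% h x v :=
  haveI : FiniteDimensional ℝ (TangentSpace 𝓘(ℝ, E) x) := inferInstanceAs (FiniteDimensional ℝ E)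
  LinearMap.BilinForm.apply_toDual_symm_apply (B := bilinOfAlternating (Ω.val x).toAlternatingMap)
    (hB := nondegenerate_bilinOfAlternating_iff.2 (hΩ x)) (d% h x : _ →ₗ[ℝ] ℝ) v

theorem eq_hamiltonianField (hΩ : Ω.Nondegenerate) {h : M → ℝ} {x : M}
    {X : TangentSpace 𝓘(ℝ, E) x} (hX : ∀ v, Ω.val x ![X, v] = d% h x v) :
    X = hamiltonianField hΩ h x := by
  let B := bilinOfAlternating (Ω.val x).toAlternatingMap
  have hB : B X = B (hamiltonianField hΩ h x) :=
    LinearMap.ext fun v => (hX v).trans (apply_hamiltonianField hΩ h x v).symm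
  refine sub_eq_zero.1 (hΩ x _ fun v => ?_)
  change B (X - hamiltonianField hΩ h x) v = 0
  rw [map_sub, hB, sub_self, LinearMap.zero_apply]

theorem Nondegenerate.contMDiff_of_apply_eq [IsManifold 𝓘(ℝ, E) ∞ M] (hΩ : Ω.Nondegenerate)
    {h : M → ℝ} (hh : CMDiff ∞ h) {X : ∀ x : M, TangentSpace 𝓘(ℝ, E) x}
    (hX : ∀ x v, Ω.val x ![X x, v] = d% h x v) : CMDiff ∞ (T% X) := by
  refine contMDiff_vectorField_of_chartAt fun p => ?_
  set φ := chartAt E p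
  have hφ : φ ∈ atlas E M := chart_mem_atlas E p
  have hdh : ContDiffOn ℝ ∞ (fderiv ℝ (h ∘ φ.symm)) φ.target :=
    (hh.comp_contMDiffOn (contMDiffOn_chart_symm (x := p))).contDiffOn.fderiv_of_isOpen
      φ.open_target (by simp)
  refine contDiffOn_of_alternating_apply_eq (Ω.smooth φ hφ) hdh
    (fun _ hy => hΩ.inChart hφ hy) fun y hy w => ?_
  have hchain := mfderiv_comp y (hh.mdifferentiableAt (x := φ.symm y) (by simp))
    ((mdifferentiable_of_mem_atlas hφ).mdifferentiableAt_symm hy)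
  rw [mfderiv_eq_fderiv] at hchain
  exact (Ω.inChart_mfderiv_apply hφ hy _ w).trans
    ((hX _ _).trans (DFunLike.congr_fun hchain w).symm)

end DiffForm

theorem continuous_wedgePow {V : Type*} [NormedAddCommGroup V] [NormedSpace ℝ V] {n : ℕ}
    (v : Fin (2 * n) → V) : Continuous fun α : V [⋀^Fin 2]→L[ℝ] ℝ => wedgePow α n v :=
  continuous_const.mul <| continuous_finsetSum _ fun _ _ => continuous_const.mul <|
    continuous_finsetProd _ fun _ _ => (ContinuousAlternatingMap.apply ℝ V ℝ _).continuous

local notation "𝔼" n:max => EuclideanSpace ℝ (Fin (2 * n))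

section

variable {n : ℕ} {M : Type*} [TopologicalSpace M] [ChartedSpace (𝔼 n) M]

/-- The density of the measure `|Ωⁿ|` with respect to Lebesgue measure in the chart at `p`. -/
def chartDensity (Ω : DiffForm (𝔼 n) M 2) (p : M) (y : 𝔼 n) : ℝ :=
  |wedgePow (Ω.inChart (chartAt (𝔼 n) p) y) n (fun j => EuclideanSpace.single j (1 : ℝ))|

theorem continuousOn_chartDensity (Ω : DiffForm (𝔼 n) M 2) (p : M) :
    ContinuousOn (chartDensity Ω p) (chartAt (𝔼 n) p).target := by
  have hΩ : ContinuousOn (Ω.inChart (chartAt (𝔼 n) p)) (chartAt (𝔼 n) p).target :=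
    (Ω.smooth _ (chart_mem_atlas _ p)).continuousOn
  exact ((continuous_wedgePow fun j => EuclideanSpace.single j (1 : ℝ)).comp_continuousOn hΩ).abs

variable [IsManifold 𝓘(ℝ, 𝔼 n) ∞ M] {Ω : DiffForm (𝔼 n) M 2}

theorem chartDensity_pos (hΩ : Ω.Nondegenerate) {p : M} {y : 𝔼 n}
    (hy : y ∈ (chartAt (𝔼 n) p).target) : 0 < chartDensity Ω p y := by
  have hbasis : ⇑(EuclideanSpace.basisFun (Fin (2 * n)) ℝ).toBasis =
      fun j => EuclideanSpace.single j (1 : ℝ) := by ext1 j; simp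
  rw [chartDensity, abs_pos, ← hbasis]
  exact wedgePow_basis_ne_zero (hΩ.inChart (chart_mem_atlas _ p) hy) _

variable [T2Space M] [SigmaCompactSpace M]

theorem tsupport_chartPartition_subset (p : M) :
    tsupport (chartPartition n M p) ⊆ (chartAt (𝔼 n) p).source :=
  Classical.choose_spec (SmoothPartitionOfUnity.exists_isSubordinate_chartAt_source
    𝓘(ℝ, 𝔼 n) M) p

/-- The coordinate expression, in the chart at `p`, of the summand `ρ_p f |Ωⁿ|` of the integral
of `f`. It is meaningful only on the target of the chart. -/
def chartIntegrand (Ω : DiffForm (𝔼 n) M 2) (f : M → ℝ) (p : M) (y : 𝔼 n) : ℝ :=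
  chartPartition n M p ((chartAt (𝔼 n) p).symm y) * f ((chartAt (𝔼 n) p).symm y) *
    chartDensity Ω p y

theorem symplecticIntegral_eq_finsum (Ω : DiffForm (𝔼 n) M 2) (f : M → ℝ) :
    symplecticIntegral Ω f =
      ∑ᶠ p : M, ∫ y in (chartAt (𝔼 n) p).target, chartIntegrand Ω f p y := rfl

theorem symm_mem_support_of_chartIntegrand_ne_zero {f : M → ℝ} {p : M} {y : 𝔼 n}
    (h : chartIntegrand Ω f p y ≠ 0) :
    (chartAt (𝔼 n) p).symm y ∈ Function.support (chartPartition n M p) ∩ Function.support f :=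
  ⟨left_ne_zero_of_mul (left_ne_zero_of_mul h), right_ne_zero_of_mul (left_ne_zero_of_mul h)⟩

theorem continuousOn_chartIntegrand (Ω : DiffForm (𝔼 n) M 2) {f : M → ℝ} (hf : Continuous f)
    (p : M) : ContinuousOn (chartIntegrand Ω f p) (chartAt (𝔼 n) p).target := by
  have hsymm := (chartAt (𝔼 n) p).continuousOn_symm
  have hρ : Continuous (chartPartition n M p) := (chartPartition n M p).contMDiff.continuous
  exact ((hρ.comp_continuousOn hsymm).mul (hf.comp_continuousOn hsymm)).mul
    (continuousOn_chartDensity Ω p)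

theorem integrableOn_chartIntegrand (Ω : DiffForm (𝔼 n) M 2) {f : M → ℝ} (hf : Continuous f)
    (hfc : HasCompactSupport f) (p : M) :
    IntegrableOn (chartIntegrand Ω f p) (chartAt (𝔼 n) p).target := by
  set φ := chartAt (𝔼 n) p
  let K : Set M := tsupport (chartPartition n M p) ∩ tsupport f
  have hKφ : K ⊆ φ.source := Set.inter_subset_left.trans (tsupport_chartPartition_subset p)
  have hK : IsCompact (φ '' K) :=
    (hfc.isCompact.inter_left (isClosed_tsupport _)).image_of_continuousOn (φ.continuousOn.mono hKφ)
  have hKtarget : φ '' K ⊆ φ.target := (Set.image_mono hKφ).trans φ.image_source_eq_target.subset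
  have hint : IntegrableOn (chartIntegrand Ω f p) (φ '' K) :=
    ((continuousOn_chartIntegrand Ω hf p).mono hKtarget).integrableOn_compact hK
  refine hint.of_forall_sdiff_eq_zero φ.open_target.measurableSet fun y hy => ?_
  by_contra hne
  have hyK : φ.symm y ∈ K :=
    Set.inter_subset_inter (subset_tsupport _) (subset_tsupport _)
      (symm_mem_support_of_chartIntegrand_ne_zero hne)
  exact hy.2 ⟨_, hyK, φ.right_inv hy.1⟩

theorem finite_support_integral_chartIntegrand (Ω : DiffForm (𝔼 n) M 2) {f : M → ℝ}
    (hfc : HasCompactSupport f) :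
    (Function.support fun p : M =>
      ∫ y in (chartAt (𝔼 n) p).target, chartIntegrand Ω f p y).Finite := by
  refine ((chartPartition n M).locallyFinite.finite_nonempty_inter_compact
    hfc.isCompact).subset fun p hp => ?_
  obtain ⟨y, -, hy⟩ := exists_ne_zero_of_setIntegral_ne_zero hp
  have hmem := symm_mem_support_of_chartIntegrand_ne_zero hy
  exact ⟨_, hmem.1, subset_tsupport _ hmem.2⟩

theorem symplecticIntegral_add (Ω : DiffForm (𝔼 n) M 2) {f g : M → ℝ} (hf : Continuous f)
    (hfc : HasCompactSupport f) (hg : Continuous g) (hgc : HasCompactSupport g) :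
    symplecticIntegral Ω (f + g) = symplecticIntegral Ω f + symplecticIntegral Ω g := by
  simp only [symplecticIntegral_eq_finsum]
  rw [← finsum_add_distrib (finite_support_integral_chartIntegrand Ω hfc)
      (finite_support_integral_chartIntegrand Ω hgc)]
  refine finsum_congr fun p => ?_
  rw [← integral_add (integrableOn_chartIntegrand Ω hf hfc p)
    (integrableOn_chartIntegrand Ω hg hgc p)]
  refine integral_congr_ae (.of_forall fun y => ?_)
  simp only [chartIntegrand, Pi.add_apply]
  ring

theorem symplecticIntegral_neg (Ω : DiffForm (𝔼 n) M 2) (f : M → ℝ) :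
    symplecticIntegral Ω (-f) = -symplecticIntegral Ω f := by
  simp only [symplecticIntegral_eq_finsum, ← finsum_neg_distrib, ← integral_neg, chartIntegrand,
    Pi.neg_apply, mul_neg, neg_mul]

theorem symplecticIntegral_pos (hΩ : Ω.Nondegenerate) {f : M → ℝ} (hf : Continuous f)
    (hfc : HasCompactSupport f) (hf0 : 0 ≤ f) {x : M} (hx : 0 < f x) :
    0 < symplecticIntegral Ω f := by
  have hnonneg : ∀ p, 0 ≤ chartIntegrand Ω f p := fun p y =>
    mul_nonneg (mul_nonneg ((chartPartition n M).nonneg p _) (hf0 _)) (abs_nonneg _)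
  obtain ⟨p, hp⟩ := (chartPartition n M).exists_pos_of_mem (Set.mem_univ x)
  rw [symplecticIntegral_eq_finsum]
  refine finsum_pos (fun p => integral_nonneg (hnonneg p)) ⟨p, ?_⟩
    (finite_support_integral_chartIntegrand Ω hfc)
  set φ := chartAt (𝔼 n) p
  have hxφ : x ∈ φ.source := tsupport_chartPartition_subset p (subset_tsupport _ hp.ne')
  have hpos : 0 < chartIntegrand Ω f p (φ x) := by
    refine mul_pos (mul_pos ?_ ?_) (chartDensity_pos hΩ (φ.map_source hxφ)) <;>
      rwa [φ.left_inv hxφ]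
  have hopen : IsOpen (φ.target ∩ Function.support (chartIntegrand Ω f p)) :=
    (continuousOn_chartIntegrand Ω hf p).isOpen_inter_preimage φ.open_target isOpen_compl_singleton
  rw [setIntegral_pos_iff_support_of_nonneg_ae (.of_forall (hnonneg p))
    (integrableOn_chartIntegrand Ω hf hfc p), Set.inter_comm]
  exact hopen.measure_pos volume ⟨φ x, φ.map_source hxφ, hpos.ne'⟩

theorem nonpos_of_symplecticIntegral_sq_mul_eq_zero (hΩ : Ω.Nondegenerate) {f : M → ℝ}
    (hf : Continuous f)
    (h : ∀ a : M → ℝ, ContMDiff 𝓘(ℝ, 𝔼 n) 𝓘(ℝ) ∞ a → HasCompactSupport a →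
      symplecticIntegral Ω (a ^ 2 * f) = 0)
    (x : M) : f x ≤ 0 := by
  by_contra! hx
  obtain ⟨b, hb, -⟩ := (SmoothBumpFunction.nhds_basis_support (I := 𝓘(ℝ, 𝔼 n))
    ((isOpen_Ioi.preimage hf).mem_nhds hx)).mem_iff.1 Filter.univ_mem
  have hnonneg : 0 ≤ (b : M → ℝ) ^ 2 * f := fun z => by
    rcases eq_or_ne (b z) 0 with hz | hz
    · simp [hz]
    · exact mul_nonneg (sq_nonneg _) (hb (subset_tsupport _ hz)).le
  have hc : HasCompactSupport ((b : M → ℝ) ^ 2 * f) := by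
    simpa only [sq] using (b.hasCompactSupport.mul_right.mul_right)
  refine (symplecticIntegral_pos hΩ ((b.continuous.pow 2).mul hf) hc hnonneg (x := x) ?_).ne'
    (h b b.contMDiff b.hasCompactSupport)
  simpa [b.eq_one] using hx

theorem eq_zero_of_symplecticIntegral_sq_mul_eq_zero (hΩ : Ω.Nondegenerate) {f : M → ℝ}
    (hf : Continuous f)
    (h : ∀ a : M → ℝ, ContMDiff 𝓘(ℝ, 𝔼 n) 𝓘(ℝ) ∞ a → HasCompactSupport a →
      symplecticIntegral Ω (a ^ 2 * f) = 0) :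
    f = 0 := by
  have hneg (a : M → ℝ) (ha : ContMDiff 𝓘(ℝ, 𝔼 n) 𝓘(ℝ) ∞ a) (hac : HasCompactSupport a) :
      symplecticIntegral Ω (a ^ 2 * -f) = 0 := by
    rw [mul_neg, symplecticIntegral_neg, h a ha hac, neg_zero]
  exact funext fun x => le_antisymm (nonpos_of_symplecticIntegral_sq_mul_eq_zero hΩ hf h x)
    (neg_nonpos.1 (nonpos_of_symplecticIntegral_sq_mul_eq_zero hΩ hf.neg hneg x))

end

theorem apply_rotation_add_apply_rotation {R V : Type*} [CommRing R] [AddCommGroup V]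
    [Module R V] (B : LinearMap.BilinForm R V) (u v : V) {c s : R} (hcs : c ^ 2 + s ^ 2 = 1) :
    B (c • u + (-s) • v) (c • u + (-s) • v) + B (s • u + c • v) (s • u + c • v) =
      B u u + B v v := by
  simp only [map_add, map_smul, LinearMap.add_apply, LinearMap.smul_apply, smul_eq_mul]
  linear_combination (B u u + B v v) * hcs

section

variable {E H M : Type*} [NormedAddCommGroup E] [NormedSpace ℝ E] [TopologicalSpace H]
  {I : ModelWithCorners ℝ E H} [TopologicalSpace M] [ChartedSpace H M]

theorem mvfderiv_mul_comp {a φ : M → ℝ} {c : ℝ → ℝ} {c' : ℝ} {x : M} (ha : MDiffAt a x)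
    (hφ : MDiffAt φ x) (hc : HasDerivAt c c' (φ x)) :
    d% (a * c ∘ φ) x = c (φ x) • d% a x + (a x * c') • d% φ x := by
  have hcφ := hc.hasFDerivAt.hasMFDerivAt.comp x hφ.hasMFDerivAt
  have hd : d% (c ∘ φ) x = c' • d% φ x :=
    hcφ.mfderiv.trans (ContinuousLinearMap.ext fun v => mul_comm (d% φ x v) c')
  rw [mvfderiv_mul ha hcφ.mdifferentiableAt, hd, smul_smul, add_comm, Function.comp_apply]

theorem mvfderiv_eq_zero_of_notMem_tsupport {h : M → ℝ} {x : M} (hx : x ∉ tsupport h) :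
    d% h x = 0 := by
  have h0 : h =ᶠ[nhds x] fun _ => (0 : ℝ) := notMem_tsupport_iff_eventuallyEq.1 hx
  exact (h0.mfderiv_eq (I := I) (I' := 𝓘(ℝ, ℝ))).trans mfderiv_const

theorem exists_contMDiff_mvfderiv_eq [FiniteDimensional ℝ E] [T2Space M] [IsManifold I ∞ M]
    (x : M) (l : E →L[ℝ] ℝ) : ∃ φ : M → ℝ, CMDiff ∞ φ ∧ d% φ x = l := by
  obtain ⟨b⟩ : Nonempty (SmoothBumpFunction I x) := inferInstance
  have hl : CMDiff[(chartAt H x).source] ∞ (fun z => l (extChartAt I x z)) :=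
    l.contMDiff.comp_contMDiffOn (contMDiffOn_extChartAt (x := x))
  refine ⟨fun z => b z • l (extChartAt I x z), b.contMDiff_smul hl, ?_⟩
  have heq : (fun z => b z • l (extChartAt I x z)) =ᶠ[nhds x] (l ∘ extChartAt I x) := by
    filter_upwards [b.eventuallyEq_one] with z hz
    simp [hz]
  have hchart : HasMFDerivAt% (extChartAt I x) x (ContinuousLinearMap.id ℝ E) :=
    mfderiv_extChartAt_self (I := I) (x := x) ▸
      (mdifferentiableAt_extChartAt (mem_chart_source H x)).hasMFDerivAt
  exact heq.mfderiv_eq.trans (l.hasFDerivAt.hasMFDerivAt.comp x hchart).mfderiv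

end

namespace DiffForm

section

variable {E : Type*} [NormedAddCommGroup E] [NormedSpace ℝ E] [FiniteDimensional ℝ E] {M : Type*}
  [TopologicalSpace M] [ChartedSpace E M] {Ω : DiffForm E M 2}

theorem hamiltonianField_eq_zero_of_notMem_tsupport (hΩ : Ω.Nondegenerate) {h : M → ℝ} {x : M}
    (hx : x ∉ tsupport h) : hamiltonianField hΩ h x = 0 := by
  rw [hamiltonianField, mvfderiv_eq_zero_of_notMem_tsupport hx]
  exact map_zero _

theorem hamiltonianField_mul_comp (hΩ : Ω.Nondegenerate) {a φ : M → ℝ} {c : ℝ → ℝ} {c' : ℝ}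
    {x : M} (ha : MDiffAt a x) (hφ : MDiffAt φ x) (hc : HasDerivAt c c' (φ x)) :
    hamiltonianField hΩ (a * c ∘ φ) x =
      c (φ x) • hamiltonianField hΩ a x + c' • a x • hamiltonianField hΩ φ x := by
  have hd : (d% (a * c ∘ φ) x : TangentSpace 𝓘(ℝ, E) x →ₗ[ℝ] ℝ) =
      c (φ x) • (d% a x : TangentSpace 𝓘(ℝ, E) x →ₗ[ℝ] ℝ) + c' • a x • d% φ x := by
    rw [mvfderiv_mul_comp ha hφ hc, mul_comm, mul_smul]
    rfl
  simp only [hamiltonianField, hd, map_add, map_smul]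

theorem exists_hamiltonianField_eq [T2Space M] [IsManifold 𝓘(ℝ, E) ∞ M] (hΩ : Ω.Nondegenerate)
    (x : M) (v : TangentSpace 𝓘(ℝ, E) x) :
    ∃ φ : M → ℝ, CMDiff ∞ φ ∧ hamiltonianField hΩ φ x = v := by
  let l : E →ₗ[ℝ] ℝ := bilinOfAlternating (Ω.val x).toAlternatingMap v
  obtain ⟨φ, hφ, hd⟩ := exists_contMDiff_mvfderiv_eq (I := 𝓘(ℝ, E)) x l.toContinuousLinearMap
  exact ⟨φ, hφ, (eq_hamiltonianField hΩ fun w => (DFunLike.congr_fun hd w).symm).symm⟩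

/-- The function `T(X_h, X_h)`. -/
def hamiltonianEnergy (hΩ : Ω.Nondegenerate)
    (T : ∀ x : M, TangentSpace 𝓘(ℝ, E) x →L[ℝ] TangentSpace 𝓘(ℝ, E) x →L[ℝ] ℝ) (h : M → ℝ)
    (x : M) : ℝ :=
  T x (hamiltonianField hΩ h x) (hamiltonianField hΩ h x)

variable (hΩ : Ω.Nondegenerate)
  {T : ∀ x : M, TangentSpace 𝓘(ℝ, E) x →L[ℝ] TangentSpace 𝓘(ℝ, E) x →L[ℝ] ℝ}

theorem continuous_hamiltonianEnergy [IsManifold 𝓘(ℝ, E) ∞ M]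
    (hT : Continuous fun x => Bundle.TotalSpace.mk' (E →L[ℝ] E →L[ℝ] ℝ) x (T x)) {h : M → ℝ}
    (hh : CMDiff ∞ h) : Continuous (hamiltonianEnergy hΩ T h) := by
  have hX := (hΩ.contMDiff_of_apply_eq hh (apply_hamiltonianField hΩ h)).continuous
  have hTX := Continuous.clm_bundle_apply₂ (F₃ := ℝ) (E₃ := Bundle.Trivial M ℝ) hT hX hX
  exact continuous_iff_continuousAt.2 fun x =>
    (FiberBundle.continuousAt_section ℝ x).1 hTX.continuousAt

variable (T) in
theorem hasCompactSupport_hamiltonianEnergy {h : M → ℝ} (hc : HasCompactSupport h) :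
    HasCompactSupport (hamiltonianEnergy hΩ T h) :=
  hc.mono' fun x hx => by
    by_contra hxh
    simp [hamiltonianEnergy, hamiltonianField_eq_zero_of_notMem_tsupport hΩ hxh] at hx

variable (T) in
theorem hamiltonianEnergy_mul_cos_add_mul_sin {a φ : M → ℝ} {x : M} (ha : MDiffAt a x)
    (hφ : MDiffAt φ x) :
    hamiltonianEnergy hΩ T (a * Real.cos ∘ φ) x + hamiltonianEnergy hΩ T (a * Real.sin ∘ φ) x =
      hamiltonianEnergy hΩ T a x + a x ^ 2 * hamiltonianEnergy hΩ T φ x := by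
  have hrot := apply_rotation_add_apply_rotation (T x).toBilinForm (hamiltonianField hΩ a x)
    (a x • hamiltonianField hΩ φ x) (Real.cos_sq_add_sin_sq (φ x))
  rw [← hamiltonianField_mul_comp hΩ ha hφ (Real.hasDerivAt_cos (φ x)),
    ← hamiltonianField_mul_comp hΩ ha hφ (Real.hasDerivAt_sin (φ x))] at hrot
  refine hrot.trans ?_
  simp only [map_smul, LinearMap.smul_apply, smul_eq_mul, ← mul_assoc, ← sq]
  rfl

end

section

variable {n : ℕ} {M : Type*} [TopologicalSpace M] [ChartedSpace (𝔼 n) M]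
  [IsManifold 𝓘(ℝ, 𝔼 n) ∞ M] {Ω : DiffForm (𝔼 n) M 2} (hΩ : Ω.Nondegenerate)

/-- The Hamiltonian vector field of a smooth function, bundled as a smooth vector field. -/
def smoothHamiltonianField {h : M → ℝ} (hh : ContMDiff 𝓘(ℝ, 𝔼 n) 𝓘(ℝ) ∞ h) :
    SmoothVectorField n M :=
  ⟨hamiltonianField hΩ h, hΩ.contMDiff_of_apply_eq hh (apply_hamiltonianField hΩ h)⟩

theorem smoothHamiltonianField_mem_compactHamiltonianFields {h : M → ℝ}
    (hh : ContMDiff 𝓘(ℝ, 𝔼 n) 𝓘(ℝ) ∞ h) (hc : HasCompactSupport h) :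
    smoothHamiltonianField hΩ hh ∈ compactHamiltonianFields Ω := by
  refine ⟨hc.isCompact.of_isClosed_subset isClosed_closure
    (closure_minimal (fun x hx => ?_) (isClosed_tsupport h)), h, hh, apply_hamiltonianField hΩ h⟩
  by_contra hxh
  exact hx (hamiltonianField_eq_zero_of_notMem_tsupport hΩ hxh)

variable [T2Space M] [SigmaCompactSpace M]
  {T : ∀ x : M, TangentSpace 𝓘(ℝ, 𝔼 n) x →L[ℝ] TangentSpace 𝓘(ℝ, 𝔼 n) x →L[ℝ] ℝ}

theorem symplecticIntegral_sq_mul_hamiltonianEnergy_eq_zero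
    (hT : Continuous fun x => Bundle.TotalSpace.mk' (𝔼 n →L[ℝ] 𝔼 n →L[ℝ] ℝ) x (T x))
    (hint : ∀ X ∈ compactHamiltonianFields Ω, symplecticIntegral Ω (fun x => T x (X x) (X x)) = 0)
    {a φ : M → ℝ} (ha : ContMDiff 𝓘(ℝ, 𝔼 n) 𝓘(ℝ) ∞ a) (hac : HasCompactSupport a)
    (hφ : ContMDiff 𝓘(ℝ, 𝔼 n) 𝓘(ℝ) ∞ φ) :
    symplecticIntegral Ω (a ^ 2 * hamiltonianEnergy hΩ T φ) = 0 := by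
  have henergy {h : M → ℝ} (hh : ContMDiff 𝓘(ℝ, 𝔼 n) 𝓘(ℝ) ∞ h) (hc : HasCompactSupport h) :
      symplecticIntegral Ω (hamiltonianEnergy hΩ T h) = 0 :=
    hint _ (smoothHamiltonianField_mem_compactHamiltonianFields hΩ hh hc)
  have hcont {h : M → ℝ} (hh : ContMDiff 𝓘(ℝ, 𝔼 n) 𝓘(ℝ) ∞ h) :=
    continuous_hamiltonianEnergy hΩ hT hh
  have henergyc {h : M → ℝ} (hc : HasCompactSupport h) :=
    hasCompactSupport_hamiltonianEnergy hΩ T hc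
  have hcos : ContMDiff 𝓘(ℝ, 𝔼 n) 𝓘(ℝ) ∞ (a * Real.cos ∘ φ) :=
    ha.mul (Real.contDiff_cos.contMDiff.comp hφ)
  have hsin : ContMDiff 𝓘(ℝ, 𝔼 n) 𝓘(ℝ) ∞ (a * Real.sin ∘ φ) :=
    ha.mul (Real.contDiff_sin.contMDiff.comp hφ)
  have hrot : hamiltonianEnergy hΩ T (a * Real.cos ∘ φ) +
      hamiltonianEnergy hΩ T (a * Real.sin ∘ φ) =
        hamiltonianEnergy hΩ T a + a ^ 2 * hamiltonianEnergy hΩ T φ :=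
    funext fun x => hamiltonianEnergy_mul_cos_add_mul_sin hΩ T
      (ha.mdifferentiableAt (by simp)) (hφ.mdifferentiableAt (by simp))
  have hac2 : HasCompactSupport (a ^ 2 * hamiltonianEnergy hΩ T φ) := by
    simpa only [sq] using hac.mul_right.mul_right
  have hsum := congrArg (symplecticIntegral Ω) hrot
  rw [symplecticIntegral_add Ω (hcont hcos) (henergyc hac.mul_right) (hcont hsin)
      (henergyc hac.mul_right),
    symplecticIntegral_add Ω (hcont ha) (henergyc hac) ((ha.continuous.pow 2).mul (hcont hφ)) hac2,
    henergy hcos hac.mul_right, henergy hsin hac.mul_right, henergy ha hac] at hsum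
  linarith

end

end DiffForm

theorem mainTheorem8_general (n : ℕ) (M : Type*) [TopologicalSpace M] [T2Space M]
    [SigmaCompactSpace M] [ChartedSpace (𝔼 n) M] [IsManifold 𝓘(ℝ, 𝔼 n) ∞ M]
    (Ω : DiffForm (𝔼 n) M 2) (hΩ : Ω.Nondegenerate)
    (T : ∀ x : M, TangentSpace 𝓘(ℝ, 𝔼 n) x →L[ℝ] TangentSpace 𝓘(ℝ, 𝔼 n) x →L[ℝ] ℝ)
    (hT : Continuous fun x => Bundle.TotalSpace.mk' (𝔼 n →L[ℝ] 𝔼 n →L[ℝ] ℝ) x (T x))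
    (hint : ∀ X ∈ compactHamiltonianFields Ω, symplecticIntegral Ω (fun x => T x (X x) (X x)) = 0)
    (x : M) (v : TangentSpace 𝓘(ℝ, 𝔼 n) x) : T x v v = 0 := by
  obtain ⟨φ, hφ, rfl⟩ := DiffForm.exists_hamiltonianField_eq hΩ x v
  have henergy : DiffForm.hamiltonianEnergy hΩ T φ = 0 :=
    eq_zero_of_symplecticIntegral_sq_mul_eq_zero hΩ
      (DiffForm.continuous_hamiltonianEnergy hΩ hT hφ) fun _ ha hac =>
        DiffForm.symplecticIntegral_sq_mul_hamiltonianEnergy_eq_zero hΩ hT hint ha hac hφ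
  exact congrFun henergy x

theorem mainTheorem8 (n : ℕ) (M : Type*) [TopologicalSpace M] [T2Space M] [SigmaCompactSpace M]
    [ChartedSpace (EuclideanSpace ℝ (Fin (2 * n))) M]
    [IsManifold 𝓘(ℝ, EuclideanSpace ℝ (Fin (2 * n))) ∞ M]
    (Ω : DiffForm (EuclideanSpace ℝ (Fin (2 * n))) M 2) (hΩ : Ω.IsSymplectic) :
    DetectsSymmetricTensors Ω (compactHamiltonianFields Ω) := by
  intro T hsymm hint x v w
  have hdiag (u : TangentSpace 𝓘(ℝ, 𝔼 n) x) : T x u u = 0 :=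
    mainTheorem8_general n M Ω hΩ.2 T T.contMDiff.continuous (fun X hX => hint X hX X hX) x u
  have hB : (T x).toBilinForm = 0 :=
    LinearMap.BilinForm.ext_of_isSymm ⟨hsymm x⟩ ⟨fun _ _ => rfl⟩ hdiag
  exact LinearMap.congr_fun₂ hB v w

end
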